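/- Consider an incomplete information game with players $i=1,\dots,n$, given as follows. There are a measurable space $(S,\mathcal S)$ of payoff types and measurable spaces $(T_i,\mathcal T_i)$ of types of the players, where each $\sigma$-algebra $\mathcal T_i$ is universally complete (it contains every subset of $T_i$ that is measurable for the completion of each probability measure on $\mathcal T_i$). Each action space $A_i$ is a compact metrizable space with its Borel $\sigma$-algebra. Write $T=\prod_i T_i$, $A=\prod_i A_i$, $T_{-i}=\prod_{j\ne i}T_j$, with product $\sigma$-algebras, and $A_{-i}=\prod_{j\ne i}A_j$. The payoff functions $u_i:A\times S\times T\to\mathbb R$ are measurable, and the belief map of player $i$ is a probability kernel $\eta_i$ from $T_i$ to $S\times T_{-i}$. Assume that (a) for each $i$, $\overline u_i:T_i\to[0,\infty)$ is a measurable map with $|u_i(a,s,t)|\le\overline u_i(t_i)$ for all $(a,s,t)\in A\times S\times T$; (b) for each $i$, $a_{-i}\in A_{-i}$ and $(s,t)\in S\times T$, the map $a_i\mapsto u_i(a_i,a_{-i},s,t)$ is upper semicontinuous on $A_i$. Let $\mathcal R_i$ be the set of behavioral strategies of player $i$, i.e. of probability kernels $\gamma_i$ from $T_i$ to $A_i$,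 and let $\mathcal R=\prod_i\mathcal R_i$. For $\gamma\in\mathcal R$ put $$V_i(\gamma;s,t)=\int_{A_1}\cdots\int_{A_n}u_i(a,s,t)\,\gamma_1(t_1,da_1)\cdots\gamma_n(t_n,da_n),\qquad U_i(\gamma;t_i)=\int_{S\times T_{-i}} V_i(\gamma;s,t)\,\eta_i(t_i,d(s,t_{-i})).$$ Let $\mathcal M$ be the set of product probability measures $\nu=\nu_0\otimes\nu_1\otimes\cdots\otimes\nu_n$ on $S\times T$ ($\nu_0$ a probability measure on $S$, $\nu_i$ one on $T_i$) such that, for every $i$, $\int\overline u_i\,d\nu_i<\infty$ and $\eta_i(t_i,\cdot)\ll\nu_0\otimes\bigotimes_{j\ne i}\nu_j$ for every $t_i\in T_i$. For $\nu\in\mathcal M$, the surrogate game $G^*(\nu)$ is the game in which the action set of player $i$ is $\mathcal R_i$ and the payoff of player $i$ at $\gamma\in\mathcal R$ is $\widetilde U_i(\gamma;\nu)=\int_{T_i}U_i(\gamma;t_i)\,\nu_i(dt_i)$. Its set of Nash equilibria is $$\mathsf{NE}_\nu=\{\gamma\in\mathcal R:\ \widetilde U_i(\gamma_i,\gamma_{-i};\nu)\ge\widetilde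 U_i(\gamma_i',\gamma_{-i};\nu)\ \text{for all } i \text{ and all } \gamma_i'\in\mathcal R_i\}.$$ If $\nu,\nu'\in\mathcal M$ are mutually absolutely continuous, then $\mathsf{NE}_\nu=\mathsf{NE}_{\nu'}$. -/

import Mathlib

open MeasureTheory ProbabilityTheory
open scoped ENNReal

noncomputable section

namespace BayesGame

/-- A `σ`-algebra is universally complete if it contains every set that is measurable for the
completion of each probability measure on it. -/
def UniversallyComplete (X : Type*) [MeasurableSpace X] : Prop :=
  ∀ B : Set X,
    (∀ μ : Measure X, IsProbabilityMeasure μ → NullMeasurableSet B μ) → MeasurableSet B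

/-- Profiles `x₋ᵢ = (xⱼ)_{j ≠ i}` of the coordinates other than `i`, with the product
`σ`-algebra. -/
abbrev Others {n : ℕ} (X : Fin n → Type*) (i : Fin n) : Type _ :=
  ∀ j : {j : Fin n // j ≠ i}, X j

/-- The full profile `(xᵢ, x₋ᵢ)`. -/
def combine {n : ℕ} {X : Fin n → Type*} (i : Fin n) (x : X i) (y : Others X i) : ∀ j, X j :=
  fun j => if h : j = i then cast (congrArg X h.symm) x else y ⟨j, h⟩

theorem combine_same {n : ℕ} {X : Fin n → Type*} (i : Fin n) (x : X i) (y : Others X i) :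
    combine i x y i = x := by
  simp [combine]

theorem combine_of_ne {n : ℕ} {X : Fin n → Type*} (i : Fin n) (x : X i) (y : Others X i)
    (j : Fin n) (h : j ≠ i) : combine i x y j = y ⟨j, h⟩ := by
  simp [combine, h]

/-- A behavioral strategy: a probability kernel from own types to own actions. -/
def Strategy (X Y : Type*) [MeasurableSpace X] [MeasurableSpace Y] : Type _ :=
  {γ : Kernel X Y // IsMarkovKernel γ}

/-- Profiles of behavioral strategies. -/
abbrev Profile {n : ℕ} (T A : Fin n → Type*) [∀ i, MeasurableSpace (T i)]
    [∀ i, MeasurableSpace (A i)] : Type _ :=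
  ∀ i, Strategy (T i) (A i)

/-- An incomplete information game with players `Fin n`, payoff types `S`, type spaces `T i` and
action spaces `A i`: the payoff functions and the belief maps. -/
structure Game (n : ℕ) (S : Type*) (T A : Fin n → Type*) [MeasurableSpace S]
    [∀ i, MeasurableSpace (T i)] [∀ i, MeasurableSpace (A i)] where
  /-- The payoff `uᵢ(a, s, t)`. -/
  u : Fin n → (∀ j, A j) → S → (∀ j, T j) → ℝ
  measurable_u : ∀ i,
    Measurable (fun p : (∀ j, A j) × S × (∀ j, T j) => u i p.1 p.2.1 p.2.2)
  /-- The belief map `ηᵢ` of player `i` about the payoff type and the other players' types. -/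
  η : ∀ i, Kernel (T i) (S × Others T i)
  isMarkovKernel_η : ∀ i, IsMarkovKernel (η i)

/-- A product probability measure `⨂ᵢ νᵢ` on `S × ∏ᵢ Tᵢ`, given by its marginals. -/
structure ProductProb {n : ℕ} (S : Type*) (T : Fin n → Type*) [MeasurableSpace S]
    [∀ i, MeasurableSpace (T i)] where
  /-- The marginal `ν₀` on `S`. -/
  state : ProbabilityMeasure S
  /-- The marginals `νᵢ` on `Tᵢ`. -/
  type : ∀ i, ProbabilityMeasure (T i)

namespace ProductProb

variable {n : ℕ} {S : Type*} {T : Fin n → Type*} [MeasurableSpace S]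
  [∀ i, MeasurableSpace (T i)]

/-- The measure `ν = ν₀ ⊗ ν₁ ⊗ ⋯ ⊗ νₙ` on `S × T`. -/
def toMeasure (ν : ProductProb S T) : Measure (S × (∀ i, T i)) :=
  (ν.state : Measure S).prod (Measure.pi fun i => (ν.type i : Measure (T i)))

/-- The measure `ν₀ ⊗ ν₋ᵢ` on `S × T₋ᵢ`. -/
def others (ν : ProductProb S T) (i : Fin n) : Measure (S × Others T i) :=
  (ν.state : Measure S).prod
    (Measure.pi fun j : {j : Fin n // j ≠ i} => (ν.type j : Measure (T j)))

/-- `ν ∼ ν'`: mutual absolute continuity of the product measures on `S × T`. -/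
def Equivalent (ν ν' : ProductProb S T) : Prop :=
  ν.toMeasure ≪ ν'.toMeasure ∧ ν'.toMeasure ≪ ν.toMeasure

end ProductProb

namespace Game

variable {n : ℕ} {S : Type*} {T A : Fin n → Type*} [MeasurableSpace S]
  [∀ i, MeasurableSpace (T i)] [∀ i, MeasurableSpace (A i)]

/-- `ubar` is a profile of measurable maps `Tᵢ → [0, ∞)` with `|uᵢ(a, s, t)| ≤ ubarᵢ(tᵢ)`. -/
def IsPayoffBound (G : Game n S T A) (ubar : ∀ i, T i → ℝ) : Prop :=
  ∀ i, Measurable (ubar i) ∧ (∀ x, 0 ≤ ubar i x) ∧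
    ∀ (a : ∀ j, A j) (s : S) (t : ∀ j, T j), |G.u i a s t| ≤ ubar i (t i)

/-- Each `uᵢ(aᵢ, a₋ᵢ, s, t)` is upper semicontinuous in the own action `aᵢ`. -/
def OwnActionUSC [∀ i, TopologicalSpace (A i)] (G : Game n S T A) : Prop :=
  ∀ (i : Fin n) (a : ∀ j, A j) (s : S) (t : ∀ j, T j),
    UpperSemicontinuous (fun x : A i => G.u i (Function.update a i x) s t)

/-- `Vᵢ(γ; s, t)`: the payoff `uᵢ(·, s, t)` integrated over the actions, which are drawn
independently from `γ₁(t₁, ·), …, γₙ(tₙ, ·)`. -/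
def V (G : Game n S T A) (i : Fin n) (γ : Profile T A) (s : S) (t : ∀ j, T j) : ℝ :=
  ∫ a, G.u i a s t ∂(Measure.pi fun j => (γ j).1 (t j))

/-- The expected payoff `Uᵢ(γ; tᵢ)` of player `i` of type `tᵢ`. -/
def U (G : Game n S T A) (i : Fin n) (γ : Profile T A) (x : T i) : ℝ :=
  ∫ p, G.V i γ p.1 (combine i x p.2) ∂(G.η i x)

/-- Absolute continuity of beliefs with respect to `ν`: `ηᵢ(tᵢ, ·) ≪ ν₀ ⊗ ν₋ᵢ` for every `i` and
every `tᵢ`. -/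
def BeliefsDominatedBy (G : Game n S T A) (ν : ProductProb S T) : Prop :=
  ∀ (i : Fin n) (x : T i), G.η i x ≪ ν.others i

/-- The set `𝓜` of product probability measures that dominate the beliefs and integrate the
payoff bounds. -/
def dominating (G : Game n S T A) (ubar : ∀ i, T i → ℝ) : Set (ProductProb S T) :=
  {ν | G.BeliefsDominatedBy ν ∧
    ∀ i, ∫⁻ x, ENNReal.ofReal (ubar i x) ∂(ν.type i : Measure (T i)) < ∞}

/-- The payoff of player `i` in the surrogate game `G*(ν)`. -/
def surrogatePayoff (G : Game n S T A) (ν : ProductProb S T) (i : Fin n)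
    (γ : Profile T A) : ℝ :=
  ∫ x, G.U i γ x ∂(ν.type i : Measure (T i))

/-- The set of Nash equilibria of the surrogate game `G*(ν)`, in which the actions of player `i`
are the behavioral strategies of player `i`. -/
def surrogateNash (G : Game n S T A) (ν : ProductProb S T) : Set (Profile T A) :=
  {γ | ∀ (i : Fin n) (δ : Strategy (T i) (A i)),
    G.surrogatePayoff ν i (Function.update γ i δ) ≤ G.surrogatePayoff ν i γ}

end Game

end BayesGame

end

namespace BayesGame

/-! A surrogate equilibrium is the same thing as interim optimality for almost every type: no
strategy `δ` of player `i` gives a higher `G.U i` on a set of types of positive `ν.type i`-measure.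
Otherwise, deviating to `δ` on such a set alone would be profitable, since a type's expected payoff
sees its own strategy only at that type (`U_update_congr`). The criterion `mem_surrogateNash_iff`
involves `ν` only through the null sets of its marginals, and equivalent product measures have
equivalent marginals. -/

open scoped Classical in
/-- The strategy that follows `δ` on the measurable set `s` of types and `γ` elsewhere. -/
noncomputable def Strategy.piecewise {X Y : Type*} [MeasurableSpace X] [MeasurableSpace Y] {s : Set X}
    (hs : MeasurableSet s) (δ γ : Strategy X Y) : Strategy X Y :=
  ⟨Kernel.piecewise hs δ.1 γ.1,
    haveI := δ.2
    haveI := γ.2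
    inferInstance⟩

theorem measurable_combine {n : ℕ} {T : Fin n → Type*} [∀ i, MeasurableSpace (T i)] (i : Fin n) :
    Measurable fun p : T i × Others T i => combine i p.1 p.2 := by
  refine measurable_pi_iff.2 fun j => ?_
  by_cases h : j = i
  · subst h
    simpa only [combine_same] using measurable_fst
  · simp only [combine_of_ne _ _ _ _ h]
    exact (measurable_pi_apply _).comp measurable_snd

/-- Measurable boxes form a generating π-system, and on a box the product measure is a finite
product of measurable functions of the coordinates. -/
theorem measurable_pi_strategy {n : ℕ} {T A : Fin n → Type*} [∀ i, MeasurableSpace (T i)]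
    [∀ i, MeasurableSpace (A i)] (γ : Profile T A) :
    Measurable fun t : ∀ j, T j => Measure.pi fun j => (γ j).1 (t j) := by
  have hγ : ∀ j, IsMarkovKernel (γ j).1 := fun j => (γ j).2
  refine .measure_of_isPiSystem_of_isProbabilityMeasure generateFrom_pi.symm isPiSystem_pi ?_
  rintro _ ⟨s, hs, rfl⟩
  simp only [Measure.pi_pi]
  exact Finset.measurable_prod _ fun j _ =>
    (Kernel.measurable_coe _ (hs j (Set.mem_univ j))).comp (measurable_pi_apply j)

theorem ProductProb.Equivalent.symm {n : ℕ} {S : Type*} {T : Fin n → Type*} [MeasurableSpace S]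
    [∀ i, MeasurableSpace (T i)] {ν ν' : ProductProb S T} (h : ν.Equivalent ν') :
    ν'.Equivalent ν :=
  ⟨h.2, h.1⟩

theorem ProductProb.map_toMeasure_type {n : ℕ} {S : Type*} {T : Fin n → Type*}
    [MeasurableSpace S] [∀ i, MeasurableSpace (T i)] (ν : ProductProb S T) (i : Fin n) :
    ν.toMeasure.map (fun p => p.2 i) = (ν.type i : Measure (T i)) :=
  ((measurePreserving_eval (fun i => (ν.type i : Measure (T i))) i).comp
    measurePreserving_snd).map_eq

theorem ProductProb.Equivalent.type_absolutelyContinuous {n : ℕ} {S : Type*} {T : Fin n → Type*}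
    [MeasurableSpace S] [∀ i, MeasurableSpace (T i)] {ν ν' : ProductProb S T}
    (h : ν.Equivalent ν') (i : Fin n) :
    (ν.type i : Measure (T i)) ≪ (ν'.type i : Measure (T i)) := by
  rw [← ν.map_toMeasure_type i, ← ν'.map_toMeasure_type i]
  exact h.1.map ((measurable_pi_apply i).comp measurable_snd)

namespace Game

variable {n : ℕ} {S : Type*} {T A : Fin n → Type*} [MeasurableSpace S]
  [∀ i, MeasurableSpace (T i)] [∀ i, MeasurableSpace (A i)]

theorem stronglyMeasurable_V (G : Game n S T A) (i : Fin n) (γ : Profile T A) :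
    StronglyMeasurable fun p : S × (∀ j, T j) => G.V i γ p.1 p.2 := by
  have hγ : ∀ j, IsMarkovKernel (γ j).1 := fun j => (γ j).2
  let κ : Kernel (S × (∀ j, T j)) (∀ j, A j) :=
    ⟨fun p => Measure.pi fun j => (γ j).1 (p.2 j),
      (measurable_pi_strategy γ).comp measurable_snd⟩
  have hκ : IsMarkovKernel κ := ⟨fun p => by
    change IsProbabilityMeasure (Measure.pi fun j => (γ j).1 (p.2 j))
    infer_instance⟩
  have hu : Measurable fun q : (S × (∀ j, T j)) × (∀ j, A j) => G.u i q.2 q.1.1 q.1.2 :=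
    (G.measurable_u i).comp (measurable_snd.prodMk measurable_fst)
  exact hu.stronglyMeasurable.integral_kernel_prod_right' (κ := κ)

theorem stronglyMeasurable_U (G : Game n S T A) (i : Fin n) (γ : Profile T A) :
    StronglyMeasurable (G.U i γ) := by
  have := G.isMarkovKernel_η i
  have hV : StronglyMeasurable fun q : T i × S × Others T i =>
      G.V i γ q.2.1 (combine i q.1 q.2.2) :=
    (G.stronglyMeasurable_V i γ).comp_measurable <| (measurable_fst.comp measurable_snd).prodMk
      ((measurable_combine i).comp
        (measurable_fst.prodMk (measurable_snd.comp measurable_snd)))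
  exact hV.integral_kernel_prod_right' (κ := G.η i)

theorem IsPayoffBound.abs_V_le {G : Game n S T A} {ubar : ∀ i, T i → ℝ}
    (h : G.IsPayoffBound ubar) (i : Fin n) (γ : Profile T A) (s : S) (t : ∀ j, T j) :
    |G.V i γ s t| ≤ ubar i (t i) := by
  have hγ : ∀ j, IsMarkovKernel (γ j).1 := fun j => (γ j).2
  have hu : ∀ a, ‖G.u i a s t‖ ≤ ubar i (t i) := fun a => (h i).2.2 a s t
  simpa [V] using norm_integral_le_of_norm_le_const
    (μ := Measure.pi fun j => (γ j).1 (t j)) (.of_forall hu)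

theorem IsPayoffBound.abs_U_le {G : Game n S T A} {ubar : ∀ i, T i → ℝ}
    (h : G.IsPayoffBound ubar) (i : Fin n) (γ : Profile T A) (x : T i) :
    |G.U i γ x| ≤ ubar i x := by
  have := G.isMarkovKernel_η i
  have hV : ∀ p : S × Others T i, ‖G.V i γ p.1 (combine i x p.2)‖ ≤ ubar i x := fun p => by
    simpa only [combine_same, Real.norm_eq_abs] using h.abs_V_le i γ p.1 (combine i x p.2)
  simpa [U] using norm_integral_le_of_norm_le_const (μ := G.η i x) (.of_forall hV)

/-- Without integrability the Bochner integral defaults to `0`, and surrogate payoffs could be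
neither compared nor split over sets of types. -/
theorem integrable_U {G : Game n S T A} {ubar : ∀ i, T i → ℝ} (h : G.IsPayoffBound ubar)
    {ν : ProductProb S T} (hν : ν ∈ G.dominating ubar) (i : Fin n) (γ : Profile T A) :
    Integrable (G.U i γ) (ν.type i : Measure (T i)) := by
  have hbar : Integrable (ubar i) (ν.type i : Measure (T i)) := by
    refine ⟨(h i).1.aestronglyMeasurable, ?_⟩
    rw [hasFiniteIntegral_iff_ofReal (.of_forall (h i).2.1)]
    exact hν.2 i
  exact hbar.mono' (G.stronglyMeasurable_U i γ).aestronglyMeasurable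
    (.of_forall (h.abs_U_le i γ))

/-- The expected payoff of a player of type `x` depends on the player's own strategy only through
its value at `x`. -/
theorem U_update_congr (G : Game n S T A) (i : Fin n) (γ : Profile T A)
    {δ δ' : Strategy (T i) (A i)} {x : T i} (h : δ.1 x = δ'.1 x) :
    G.U i (Function.update γ i δ) x = G.U i (Function.update γ i δ') x := by
  unfold U V
  congr! 5 with p j
  -- The own strategy enters only through coordinate `i` of `combine i x p.2`, which is `x`.
  by_cases hj : j = i
  · subst hj
    simpa [combine_same] using h
  · simp [Function.update_of_ne hj]

/-- An equilibrium of the surrogate game is characterized by the optimality of almost every type. -/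
theorem mem_surrogateNash_iff {G : Game n S T A} {ubar : ∀ i, T i → ℝ}
    (h : G.IsPayoffBound ubar) {ν : ProductProb S T} (hν : ν ∈ G.dominating ubar)
    (γ : Profile T A) :
    γ ∈ G.surrogateNash ν ↔ ∀ (i : Fin n) (δ : Strategy (T i) (A i)),
      G.U i (Function.update γ i δ) ≤ᵐ[(ν.type i : Measure (T i))] G.U i γ := by
  refine ⟨fun hγ i δ => ?_, fun hγ i δ =>
    integral_mono_ae (integrable_U h hν i _) (integrable_U h hν i _) (hγ i δ)⟩
  refine ae_le_of_forall_setIntegral_le (integrable_U h hν i _) (integrable_U h hν i _)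
    fun s hs _ => ?_
  -- Deviating to `δ` only on `s` leaves the contribution of `sᶜ` unchanged, so it cancels and the
  -- inequality over `s` remains.
  have key := hγ i (Strategy.piecewise hs δ (γ i))
  unfold surrogatePayoff at key
  rw [← integral_add_compl hs (integrable_U h hν i _),
    ← integral_add_compl hs (integrable_U h hν i γ)] at key
  have hon : ∫ x in s, G.U i (Function.update γ i (Strategy.piecewise hs δ (γ i))) x
      ∂(ν.type i : Measure (T i)) =
      ∫ x in s, G.U i (Function.update γ i δ) x ∂(ν.type i : Measure (T i)) :=
    setIntegral_congr_fun hs fun x hx => G.U_update_congr i γ <| by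
      simp [Strategy.piecewise, Kernel.piecewise_apply, hx]
  have hoff : ∫ x in sᶜ, G.U i (Function.update γ i (Strategy.piecewise hs δ (γ i))) x
      ∂(ν.type i : Measure (T i)) =
      ∫ x in sᶜ, G.U i γ x ∂(ν.type i : Measure (T i)) := by
    refine setIntegral_congr_fun hs.compl fun x hx => ?_
    have hx' : x ∉ s := hx
    have := G.U_update_congr i γ (δ := Strategy.piecewise hs δ (γ i)) (δ' := γ i) (x := x)
      (by simp [Strategy.piecewise, Kernel.piecewise_apply, hx'])
    simpa only [Function.update_eq_self] using this
  linarith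

end Game

end BayesGame

theorem mainTheorem6 (n : ℕ) {S : Type*} {T A : Fin n → Type*} [MeasurableSpace S]
    [∀ i, MeasurableSpace (T i)]
    [∀ i, TopologicalSpace (A i)] [∀ i, CompactSpace (A i)]
    [∀ i, TopologicalSpace.MetrizableSpace (A i)]
    [∀ i, MeasurableSpace (A i)] [∀ i, BorelSpace (A i)]
    (hT : ∀ i, BayesGame.UniversallyComplete (T i))
    (G : BayesGame.Game n S T A) (ubar : ∀ i, T i → ℝ)
    (hbound : G.IsPayoffBound ubar) (husc : G.OwnActionUSC)
    (ν ν' : BayesGame.ProductProb S T)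
    (hν : ν ∈ G.dominating ubar) (hν' : ν' ∈ G.dominating ubar)
    (hequiv : ν.Equivalent ν') :
    G.surrogateNash ν = G.surrogateNash ν' := by
  ext γ
  rw [BayesGame.Game.mem_surrogateNash_iff hbound hν,
    BayesGame.Game.mem_surrogateNash_iff hbound hν']
  -- Passing from `ν` to `ν'` uses that `ν'` has the `ν`-null sets among its own, hence `symm`.
  exact ⟨fun h i δ => (hequiv.symm.type_absolutelyContinuous i).ae_le (h i δ),
    fun h i δ => (hequiv.type_absolutelyContinuous i).ae_le (h i δ)⟩
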